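/- Let $\Gamma$ be a torsion-free word-hyperbolic group (that is, $\Gamma$ has a finite generating set whose word metric is Gromov hyperbolic) which is not virtually cyclic. Then $\Gamma$ is a traveling salesman (TS) group, which means the following. Let $X$ be any finite generating set of $\Gamma$, and consider the Cayley graph of $\Gamma$ with respect to $X$, in which $g$ and $gx$ are joined by an edge whenever $x\in X$ and $x\neq 1$. For a finite set $S\subseteq\Gamma$ let $L_X(S)$ be the minimal length of a closed path (repeated vertices and edges are allowed) in this graph that passes through every element of $S$. For $\xi\in\Gamma$, call $S$ $\{\xi\}$-related if for every $x\in S$ there is $y\in S$ such that $y^{-1}x=\xi$ or $x^{-1}y=\xi$. Then for every real $\lambda>1$ there exists $\xi\in\Gamma$ such that $L_X(S)\ge\lambda|S|$ for every finite $\{\xi\}$-related set $S\subseteq\Gamma$. -/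

import Mathlib

namespace TSGroup

/-- The left-invariant word metric of `G` with respect to the generating set `X`: the path metric on
the vertices of the Cayley graph, in which `g` and `g * x` are joined for `x ∈ X`. -/
noncomputable def wordDist {G : Type*} [Group G] (X : Set G) (g h : G) : ℕ :=
  (SimpleGraph.mulCayley X).dist g h

/-- The Gromov product `(x | y)_w` of a distance function `d`. -/
noncomputable def gromovProduct {α : Type*} (d : α → α → ℝ) (w x y : α) : ℝ :=
  (d x w + d y w - d x y) / 2

/-- Gromov hyperbolicity of a distance function. -/
def IsGromovHyperbolic {α : Type*} (d : α → α → ℝ) : Prop :=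
  ∃ δ : ℝ, ∀ w x y z : α,
    min (gromovProduct d w x y) (gromovProduct d w y z) - δ ≤ gromovProduct d w x z

/-- A group is word hyperbolic if it has a finite generating set whose word metric is Gromov
hyperbolic. -/
def IsWordHyperbolic (G : Type*) [Group G] : Prop :=
  ∃ X : Finset G, Subgroup.closure (X : Set G) = ⊤ ∧
    IsGromovHyperbolic (fun g h : G => (wordDist (X : Set G) g h : ℝ))

/-- A group is virtually cyclic if it has a cyclic subgroup of finite index. -/
def IsVirtuallyCyclic (G : Type*) [Group G] : Prop :=
  ∃ H : Subgroup G, H.FiniteIndex ∧ IsCyclic H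

/-- A group is torsion-free if no element other than `1` has finite order. (Mathlib's class
`IsMulTorsionFree` asks for uniqueness of roots, which is stronger for nonabelian groups.) -/
def IsTorsionFreeGroup (G : Type*) [Group G] : Prop :=
  ∀ g : G, g ≠ 1 → ¬ IsOfFinOrder g

/-- A subset `B` of `G` is `A`-related if every `x ∈ B` has an `A`-neighbour in `B`. -/
def IsRelated {G : Type*} [Group G] (A B : Set G) : Prop :=
  ∀ x ∈ B, ∃ y ∈ B, (({y⁻¹ * x, x⁻¹ * y} : Set G) ∩ A).Nonempty

/-- The minimal length `L(S)` of a closed path in the Cayley graph with respect to `X` that passes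
through all elements of `S`. -/
noncomputable def tourLength {G : Type*} [Group G] (X : Set G) (S : Finset G) : ℕ :=
  sInf {n : ℕ | ∃ (g : G) (p : (SimpleGraph.mulCayley X).Walk g g),
    (∀ s ∈ S, s ∈ p.support) ∧ p.length = n}

/-- The traveling salesman property of `G` with respect to the generating set `X`. -/
def IsTSWith {G : Type*} [Group G] (X : Set G) : Prop :=
  ∀ l : ℝ, 1 < l → ∃ ξ : G, ∀ S : Finset G, IsRelated {ξ} (S : Set G) →
    l * (S.card : ℝ) ≤ (tourLength X S : ℝ)

/-- A finitely generated group is a TS group if it has the traveling salesman property. The property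
does not depend on the finite generating set; it is required for all of them. -/
def IsTS (G : Type*) [Group G] : Prop :=
  Group.FG G ∧ ∀ X : Finset G, Subgroup.closure (X : Set G) = ⊤ → IsTSWith (X : Set G)

end TSGroup

/-!
The travelling salesman property is reduced to the existence, for every finite set `F`, of an
element `ξ` that is long and in general position with respect to `F`: for `w ∈ F` and signs `ε`,
`ε'`, the geodesics from `1` to `ξ ^ (-ε)` and to `w * ξ ^ ε'` separate early, except when `w = 1`
and `ε' = -ε`, where they coincide (`exists_general_position`).

*Reduction.* Cut a tour through a `{ξ}`-related set `S`, of length `L`, into about `L / R` pieces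
of length `R = ⌈2 λ⌉`, and let `F` be the ball of radius `R`. Let `Γ` be the multigraph whose
vertices are the pieces and whose edges are the pairs `{x, x * ξ}` in `S`. A non-backtracking walk
in `Γ` lifts to a broken path in the group, with long pieces `ξ ^ (±1)` joined by short
corrections from `F`. By general position and the local-to-global principle for hyperbolic spaces
(`FourPoint.chain`) such a path escapes to infinity, which is impossible inside `S`. So `Γ` is a
forest and has fewer edges than vertices (`card_lt_card_image`). As `S` is related, there are at
least `|S| / 2` edges, and `|S| / 2 ≤ L / R` follows.

*Elements in general position.* An infinite hyperbolic group contains an axial (loxodromic)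
element `g` (`exists_isAxial`). If `h` is not in the commensurator `E` of `⟨g⟩`, then the
quasi-axes `⟨g⟩` and `h⟨g⟩` diverge (`exists_gromovProduct_zpow_le`); otherwise the finitely many
differences `g⁻ⁱ h gʲ` available along the common part would repeat and give a relation
`h gᵖ = g^q h`. The group `⟨g⟩` has finite index in `E`, so that no finite union of cosets of `E` is the
whole group unless that group is virtually cyclic (`exists_forall_inv_mul_notMem`). By
torsion-freeness every `w ≠ 1` lies in at most one conjugate of `E` (`inv_mul_mem_of_conj_mem`).
Hence there are `u` and `v` for which none of `u⁻¹ w u`, `v⁻¹ w v` (`w ∈ F`, `w ≠ 1`), `v⁻¹ w u`,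
`u⁻¹ w v` (`w ∈ F`) lies in `E`, and `ξ = u gᴹ v⁻¹` is as required for large `M`.
-/

namespace TSGroup

/-! ### Word metrics -/

/-- The properties of a word metric that the argument uses: a left-invariant (pseudo)metric with
finite balls, in which every element of norm at least `n` has a geodesic from `1` with a point at
distance `n`. -/
structure IsWordMetric {G : Type*} [Group G] (d : G → G → ℝ) : Prop where
  self : ∀ g, d g g = 0
  symm : ∀ g h, d g h = d h g
  tri : ∀ g h k, d g k ≤ d g h + d h k
  mul_left : ∀ k g h, d (k * g) (k * h) = d g h
  finite_ball : ∀ r : ℝ, {g | d 1 g ≤ r}.Finite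
  exists_between : ∀ (g : G) (n : ℕ), (n : ℝ) ≤ d 1 g → ∃ p, d 1 p = n ∧ d p g = d 1 g - n

section Cayley

variable {G : Type*} [Group G] {X : Set G}

theorem mulCayley_connected (hX : Subgroup.closure X = ⊤) :
    (SimpleGraph.mulCayley X).Connected := by
  have key : ∀ g h : G, (SimpleGraph.mulCayley X).Reachable h (h * g) := by
    intro g
    have hg : g ∈ Subgroup.closure X := by rw [hX]; trivial
    induction hg using Subgroup.closure_induction with
    | mem x hx =>
      intro h
      by_cases h1 : h = h * x
      · rw [← h1]
      · exact SimpleGraph.Adj.reachable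
          ((SimpleGraph.mulCayley_adj X _ _).2 ⟨h1, Or.inl (by simpa using hx)⟩)
    | one => intro h; simp
    | mul x y _ _ ihx ihy =>
      intro h
      rw [← mul_assoc]
      exact (ihx h).trans (ihy (h * x))
    | inv x _ ih =>
      intro h
      have := ih (h * x⁻¹)
      rw [inv_mul_cancel_right] at this
      exact this.symm
  refine (SimpleGraph.connected_iff _).2 ⟨fun g h => ?_, ⟨1⟩⟩
  simpa using key (g⁻¹ * h) g

theorem wordDist_mul_left (hX : Subgroup.closure X = ⊤) (k g h : G) :
    wordDist X (k * g) (k * h) = wordDist X g h := by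
  have hle : ∀ k g h : G, wordDist X (k * g) (k * h) ≤ wordDist X g h := by
    intro k g h
    obtain ⟨p, hp⟩ := (mulCayley_connected hX).exists_walk_length_eq_dist g h
    let f : SimpleGraph.mulCayley X →g SimpleGraph.mulCayley X :=
      ⟨fun x => k * x, fun hab => SimpleGraph.mulCayley_adj_mul_iff_right.2 hab⟩
    have := SimpleGraph.dist_le (p.map f)
    rw [SimpleGraph.Walk.length_map, hp] at this
    exact this
  refine le_antisymm (hle k g h) ?_
  simpa using hle k⁻¹ (k * g) (k * h)

theorem wordDist_getVert_le {u v : G} (p : (SimpleGraph.mulCayley X).Walk u v) {i j : ℕ}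
    (hij : i ≤ j) : wordDist X (p.getVert i) (p.getVert j) ≤ j - i := by
  have h := (SimpleGraph.dist_le ((p.drop i).take (j - i))).trans
    (SimpleGraph.Walk.take_length _ _ ▸ min_le_left _ _)
  rwa [SimpleGraph.Walk.drop_getVert, Nat.add_sub_cancel' hij] at h

theorem exists_wordDist_between (hX : Subgroup.closure X = ⊤) (g : G) {n : ℕ}
    (hn : n ≤ wordDist X 1 g) :
    ∃ p, wordDist X 1 p = n ∧ wordDist X p g = wordDist X 1 g - n := by
  obtain ⟨q, hq⟩ := (mulCayley_connected hX).exists_walk_length_eq_dist 1 g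
  have h1 := wordDist_getVert_le q (Nat.zero_le n)
  have h2 := wordDist_getVert_le q (i := n) (j := q.length) (hq ▸ hn)
  have h3 := (mulCayley_connected hX).dist_triangle (u := 1) (v := q.getVert n) (w := g)
  rw [SimpleGraph.Walk.getVert_zero] at h1
  rw [SimpleGraph.Walk.getVert_length] at h2
  refine ⟨q.getVert n, ?_⟩
  unfold wordDist at *
  omega

theorem finite_wordDist_le (hX : Subgroup.closure X = ⊤) (hfin : X.Finite) (n : ℕ) :
    {g : G | wordDist X 1 g ≤ n}.Finite := by
  induction n with
  | zero =>
    refine (Set.finite_singleton (1 : G)).subset fun g hg => ?_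
    have : (SimpleGraph.mulCayley X).dist 1 g = 0 := Nat.le_zero.1 hg
    exact ((mulCayley_connected hX).dist_eq_zero_iff.1 this).symm
  | succ n ih =>
    refine (ih.union (Set.Finite.image2 (· * ·) ih (hfin.union hfin.inv))).subset fun g hg => ?_
    rcases Nat.lt_or_ge n (wordDist X 1 g) with h | h
    · obtain ⟨p, hp1, hp2⟩ := exists_wordDist_between hX g h.le
      have h1 : wordDist X p g = 1 := by
        have : wordDist X 1 g ≤ n + 1 := hg
        omega
      have hadj := ((SimpleGraph.mulCayley_adj X _ _).1 (SimpleGraph.dist_eq_one_iff_adj.1 h1)).2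
      refine Or.inr ⟨p, hp1.le, p⁻¹ * g, ?_, by simp⟩
      rcases hadj with h | h
      · exact Or.inl h
      · exact Or.inr (by simpa using h)
    · exact Or.inl h

theorem isWordMetric_wordDist (hX : Subgroup.closure X = ⊤) (hfin : X.Finite) :
    IsWordMetric (fun g h : G => (wordDist X g h : ℝ)) where
  self g := by simp [wordDist]
  symm g h := by simp [wordDist, SimpleGraph.dist_comm]
  tri g h k := by
    exact_mod_cast (mulCayley_connected hX).dist_triangle
  mul_left k g h := by simp [wordDist_mul_left hX]
  finite_ball r := by
    refine (finite_wordDist_le hX hfin ⌊r⌋₊).subset fun g hg => ?_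
    exact Nat.le_floor hg
  exists_between g n hn := by
    have hn' : n ≤ wordDist X 1 g := by exact_mod_cast hn
    obtain ⟨p, h1, h2⟩ := exists_wordDist_between hX g hn'
    refine ⟨p, by simp [h1], ?_⟩
    simp [h2, Nat.cast_sub hn']

theorem exists_tour (hX : Subgroup.closure X = ⊤) (S : Finset G) (g : G) :
    ∃ p : (SimpleGraph.mulCayley X).Walk g g, ∀ s ∈ S, s ∈ p.support := by
  classical
  induction S using Finset.induction_on with
  | empty => exact ⟨.nil, by simp⟩
  | insert a S _ ih =>
    obtain ⟨p, hp⟩ := ih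
    obtain ⟨q⟩ := (mulCayley_connected hX).preconnected g a
    refine ⟨p.append (q.append q.reverse), fun s hs => ?_⟩
    simp only [SimpleGraph.Walk.mem_support_append_iff]
    rcases Finset.mem_insert.1 hs with rfl | hs
    · exact Or.inr (Or.inl q.end_mem_support)
    · exact Or.inl (hp s hs)

theorem exists_tour_length_eq (hX : Subgroup.closure X = ⊤) (S : Finset G) :
    ∃ (g : G) (p : (SimpleGraph.mulCayley X).Walk g g),
      (∀ s ∈ S, s ∈ p.support) ∧ p.length = tourLength X S := by
  obtain ⟨p, hp⟩ := exists_tour hX S 1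
  exact Nat.sInf_mem (s := {n : ℕ | ∃ (g : G) (p : (SimpleGraph.mulCayley X).Walk g g),
    (∀ s ∈ S, s ∈ p.support) ∧ p.length = n}) ⟨_, 1, p, hp, rfl⟩

end Cayley

/-! ### Non-backtracking walks in finite multigraphs -/

section Multigraph

variable {α β : Type*}

/-- The initial vertex of the dart `a` of a multigraph with edge type `α` and endpoint maps
`s, t : α → β`. The dart `(e, false)` runs along `e` from `s e` to `t e`, and `(e, true)` runs
backwards. -/
def dartSrc (s t : α → β) (a : α × Bool) : β := if a.2 then t a.1 else s a.1

/-- The reverse of a dart. -/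
def dartRev (a : α × Bool) : α × Bool := (a.1, !a.2)

/-- A finite multigraph with at least as many edges as vertices contains an infinite
non-backtracking walk: after removing edges at vertices of degree one as long as possible,
every dart has a non-backtracking continuation. -/
theorem exists_nonbacktracking_walk [DecidableEq α] [DecidableEq β] (s t : α → β) (E : Finset α)
    (hE : E.Nonempty) (hcard : (E.image s ∪ E.image t).card ≤ E.card) :
    ∃ a : ℕ → α × Bool, ∀ i, (a i).1 ∈ E ∧ dartSrc s t (a (i + 1)) = dartSrc s t (dartRev (a i)) ∧
      a (i + 1) ≠ dartRev (a i) := by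
  induction hn : E.card generalizing E with
  | zero => simp [Finset.card_eq_zero.1 hn] at hE
  | succ n ih =>
    by_cases hcont : ∀ a : α × Bool, a.1 ∈ E → ∃ b : α × Bool, b.1 ∈ E ∧
        dartSrc s t b = dartSrc s t (dartRev a) ∧ b ≠ dartRev a
    · choose! f hf using hcont
      obtain ⟨e, he⟩ := hE
      have hmem : ∀ i, (f^[i] (e, false)).1 ∈ E := by
        intro i
        induction i with
        | zero => exact he
        | succ i ihi => rw [Function.iterate_succ_apply']; exact (hf _ ihi).1
      refine ⟨fun i => f^[i] (e, false), fun i => ⟨hmem i, ?_⟩⟩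
      simp only [Function.iterate_succ_apply']
      exact (hf _ (hmem i)).2
    · push Not at hcont
      obtain ⟨a, ha, hdead⟩ := hcont
      -- The vertex at the end of `a` has degree one, so the edge of `a` can be removed.
      set v := dartSrc s t (dartRev a) with hv
      have hvE : v ∈ E.image s ∪ E.image t := by
        rw [hv, dartSrc]
        split_ifs
        · exact Finset.mem_union_right _ (Finset.mem_image_of_mem t ha)
        · exact Finset.mem_union_left _ (Finset.mem_image_of_mem s ha)
      have hsub : (E.erase a.1).image s ∪ (E.erase a.1).image t ⊆
          (E.image s ∪ E.image t).erase v := by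
        intro x hx
        refine Finset.mem_erase.2 ⟨?_, Finset.union_subset_union (Finset.image_subset_image
          (Finset.erase_subset _ _)) (Finset.image_subset_image (Finset.erase_subset _ _)) hx⟩
        rintro rfl
        rcases Finset.mem_union.1 hx with hx | hx
        · obtain ⟨e, he, hev⟩ := Finset.mem_image.1 hx
          rw [Finset.mem_erase] at he
          exact he.1 (congrArg Prod.fst (hdead (e, false) he.2 (by simpa [dartSrc] using hev)))
        · obtain ⟨e, he, hev⟩ := Finset.mem_image.1 hx
          rw [Finset.mem_erase] at he
          exact he.1 (congrArg Prod.fst (hdead (e, true) he.2 (by simpa [dartSrc] using hev)))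
      have hle := Finset.card_le_card hsub
      rw [Finset.card_erase_of_mem hvE] at hle
      have herase : (E.erase a.1).card = n := by rw [Finset.card_erase_of_mem ha]; omega
      rcases (E.erase a.1).eq_empty_or_nonempty with hempty | hne
      · -- A single edge with at most one vertex is a loop, and both its darts start at `v`.
        exfalso
        have hE1 : E = {a.1} := by
          refine Finset.eq_singleton_iff_unique_mem.2 ⟨ha, fun x hx => ?_⟩
          by_contra hxa
          simpa [hempty] using Finset.mem_erase.2 ⟨hxa, hx⟩
        have hone : (E.image s ∪ E.image t).card ≤ 1 := by
          rw [hE1] at hcard ⊢; simpa using hcard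
        have hs : s a.1 = v := Finset.card_le_one.1 hone _
          (Finset.mem_union_left _ (Finset.mem_image_of_mem s ha)) _ hvE
        have ht : t a.1 = v := Finset.card_le_one.1 hone _
          (Finset.mem_union_right _ (Finset.mem_image_of_mem t ha)) _ hvE
        have h1 := hdead (a.1, false) ha (by simpa [dartSrc] using hs)
        have h2 := hdead (a.1, true) ha (by simpa [dartSrc] using ht)
        simpa using h1.trans h2.symm
      · obtain ⟨b, hb⟩ := ih (E.erase a.1) hne (by omega) herase
        exact ⟨b, fun i => ⟨Finset.mem_of_mem_erase (hb i).1, (hb i).2⟩⟩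

end Multigraph

/-! ### Gromov products and hyperbolicity -/

section Hyperbolic

variable {G : Type*} [Group G] {d : G → G → ℝ} {δ : ℝ}

theorem IsWordMetric.nonneg (hd : IsWordMetric d) (g h : G) : 0 ≤ d g h := by
  have := hd.tri g h g
  rw [hd.self, hd.symm h g] at this
  linarith

theorem IsWordMetric.eq_norm (hd : IsWordMetric d) (g h : G) : d g h = d 1 (g⁻¹ * h) := by
  rw [← hd.mul_left g⁻¹ g h, inv_mul_cancel]

theorem IsWordMetric.norm_inv (hd : IsWordMetric d) (g : G) : d 1 g⁻¹ = d 1 g := by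
  rw [← hd.mul_left g, mul_one, mul_inv_cancel, hd.symm]

theorem IsWordMetric.dist_mul_right (hd : IsWordMetric d) (g h : G) : d g (g * h) = d 1 h := by
  rw [hd.eq_norm, inv_mul_cancel_left]

theorem IsWordMetric.dist_mul_left_self (hd : IsWordMetric d) (g h : G) :
    d (g * h) g = d 1 h := by
  rw [hd.symm, hd.dist_mul_right]

theorem gromovProduct_one (hd : IsWordMetric d) (x y : G) :
    gromovProduct d 1 x y = (d 1 x + d 1 y - d 1 (x⁻¹ * y)) / 2 := by
  rw [gromovProduct, hd.symm x 1, hd.symm y 1, hd.eq_norm x y]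

theorem IsWordMetric.norm_mul_le (hd : IsWordMetric d) (g h : G) :
    d 1 (g * h) ≤ d 1 g + d 1 h := by
  have := hd.tri 1 g (g * h)
  rwa [hd.dist_mul_right] at this

theorem IsWordMetric.norm_pow_le (hd : IsWordMetric d) (g : G) (n : ℕ) :
    d 1 (g ^ n) ≤ n * d 1 g := by
  induction n with
  | zero => simp [hd.self]
  | succ n ih =>
    rw [pow_succ]
    have := hd.norm_mul_le (g ^ n) g
    push_cast
    linarith

theorem IsWordMetric.exists_lt_norm [Infinite G] (hd : IsWordMetric d) (r : ℝ) :
    ∃ g, r < d 1 g := by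
  by_contra! h
  exact Set.infinite_univ ((hd.finite_ball r).subset fun g _ => h g)

theorem IsWordMetric.exists_lt_norm_pow (hd : IsWordMetric d) {g : G} (hg : ¬ IsOfFinOrder g)
    (r : ℝ) : ∃ n : ℕ, r < d 1 (g ^ n) := by
  by_contra! h
  exact Set.infinite_range_of_injective (injective_pow_iff_not_isOfFinOrder.2 hg)
    ((hd.finite_ball r).subset (by rintro _ ⟨n, rfl⟩; exact h n))

theorem gromovProduct_mul_left (hd : IsWordMetric d) (k w x y : G) :
    gromovProduct d (k * w) (k * x) (k * y) = gromovProduct d w x y := by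
  simp only [gromovProduct, hd.mul_left]

theorem gromovProduct_comm (hd : IsWordMetric d) (w x y : G) :
    gromovProduct d w x y = gromovProduct d w y x := by
  simp only [gromovProduct, hd.symm x y]
  ring

theorem gromovProduct_nonneg (hd : IsWordMetric d) (w x y : G) : 0 ≤ gromovProduct d w x y := by
  have := hd.tri x w y
  rw [hd.symm w y] at this
  simp only [gromovProduct]
  linarith

theorem gromovProduct_le_left (hd : IsWordMetric d) (w x y : G) :
    gromovProduct d w x y ≤ d w x := by
  have := hd.tri y x w
  simp only [gromovProduct]
  linarith [hd.symm w x, hd.symm x y]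

theorem gromovProduct_le_right (hd : IsWordMetric d) (w x y : G) :
    gromovProduct d w x y ≤ d w y := by
  rw [gromovProduct_comm hd]
  exact gromovProduct_le_left hd w y x

theorem gromovProduct_add_swap (hd : IsWordMetric d) (w x y : G) :
    gromovProduct d w x y + gromovProduct d y x w = d w y := by
  simp only [gromovProduct, hd.symm w y]
  ring

/-- Gromov products are `1`-Lipschitz in all three variables. -/
theorem gromovProduct_le_add (hd : IsWordMetric d) (w x y w' x' y' : G) :
    gromovProduct d w x y ≤ gromovProduct d w' x' y' + d w w' + d x x' + d y y' := by
  simp only [gromovProduct]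
  linarith [hd.tri x x' w, hd.tri x' w' w, hd.tri y y' w, hd.tri y' w' w, hd.tri x' x y',
    hd.tri x y y', hd.symm w w', hd.symm x x', hd.symm y y']

/-- The four-point inequality defining `δ`-hyperbolicity. -/
def FourPoint (d : G → G → ℝ) (δ : ℝ) : Prop :=
  ∀ w x y z : G,
    min (gromovProduct d w x y) (gromovProduct d w y z) - δ ≤ gromovProduct d w x z

theorem FourPoint.nonneg (hd : IsWordMetric d) (hδ : FourPoint d δ) : 0 ≤ δ := by
  have := hδ 1 1 1 1
  simp only [gromovProduct, hd.self, min_self] at this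
  linarith

theorem FourPoint.min_three (hd : IsWordMetric d) (hδ : FourPoint d δ) (o x z z' y : G) {t : ℝ}
    (h1 : t ≤ gromovProduct d o x z) (h2 : t ≤ gromovProduct d o z z')
    (h3 : t ≤ gromovProduct d o z' y) : t - 2 * δ ≤ gromovProduct d o x y := by
  have h4 := hδ o x z z'
  have h5 := hδ o x z' y
  have h6 := hδ.nonneg hd
  have h7 : t - δ ≤ gromovProduct d o x z' := by linarith [le_min h1 h2]
  have h8 : t - δ ≤ min (gromovProduct d o x z') (gromovProduct d o z' y) :=
    le_min h7 (by linarith)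
  linarith

/-- Geodesics fellow-travel: if `x` lies close to a geodesic from `o` to `z`, `y` lies close to a
geodesic from `o` to `z'`, both at about the same distance from `o`, and the two geodesics do not
diverge before that distance, then `x` and `y` are close. -/
theorem FourPoint.dist_le_of_fellow (hd : IsWordMetric d) (hδ : FourPoint d δ) {o x y z z' : G}
    {a b : ℝ} (hx : gromovProduct d x o z ≤ a) (hy : gromovProduct d y o z' ≤ a)
    (hz : d o x ≤ gromovProduct d o z z' + a) (h1 : d o x ≤ d o y) (h2 : d o y ≤ d o x + b) :
    d x y ≤ b + 2 * a + 4 * δ := by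
  have hx' := gromovProduct_add_swap hd x z o
  have hy' := gromovProduct_add_swap hd y z' o
  rw [gromovProduct_comm hd x, gromovProduct_comm hd o z x, hd.symm x o] at hx'
  rw [gromovProduct_comm hd y, hd.symm y o] at hy'
  have h3 := hδ.min_three hd o x z z' y (t := d o x - a) (by linarith) (by linarith)
    (by linarith)
  simp only [gromovProduct] at h3
  linarith [hd.symm x o, hd.symm y o]

/-- Local-to-global principle: along a broken path with long pieces and small Gromov products at
the corners, the path continues to point away from its starting point `o`. -/
theorem FourPoint.chain (hd : IsWordMetric d) (hδ : FourPoint d δ) {x : ℕ → G} {o : G} {a L : ℝ}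
    (h0 : gromovProduct d (x 0) o (x 1) ≤ a + δ) (hL : ∀ i, L ≤ d (x i) (x (i + 1)))
    (ha : ∀ i, gromovProduct d (x (i + 1)) (x i) (x (i + 2)) ≤ a) (haL : 2 * a + 2 * δ < L)
    (k : ℕ) : gromovProduct d (x k) o (x (k + 1)) ≤ a + δ := by
  induction k with
  | zero => exact h0
  | succ k ih =>
    by_contra! hlt
    have h1 := gromovProduct_add_swap hd (x k) o (x (k + 1))
    have h2 := hδ (x (k + 1)) (x k) o (x (k + 2))
    have h3 : a + δ < min (gromovProduct d (x (k + 1)) (x k) o)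
        (gromovProduct d (x (k + 1)) o (x (k + 2))) := by
      rw [gromovProduct_comm hd _ (x k) o]
      exact lt_min (by linarith [hL k]) hlt
    linarith [ha k]

theorem FourPoint.le_dist_chain (hd : IsWordMetric d) (hδ : FourPoint d δ) {x : ℕ → G} {a L : ℝ}
    (hL : ∀ i, L ≤ d (x i) (x (i + 1)))
    (ha : ∀ i, gromovProduct d (x (i + 1)) (x i) (x (i + 2)) ≤ a) (haL : 2 * a + 2 * δ < L)
    (k : ℕ) : k * (L - 2 * a - 2 * δ) ≤ d (x 0) (x k) := by
  induction k with
  | zero => simp [hd.self]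
  | succ k ih =>
    have h0 : gromovProduct d (x 0) (x 0) (x 1) ≤ a + δ := by
      have h1 := gromovProduct_le_left hd (x 0) (x 0) (x 1)
      have h2 := (gromovProduct_nonneg hd _ _ _).trans (ha 0)
      linarith [hδ.nonneg hd, hd.self (x 0)]
    have h1 := hδ.chain hd h0 hL ha haL k
    simp only [gromovProduct] at h1
    push_cast
    linarith [hL k, hd.symm (x (k + 1)) (x k)]

/-! ### Axial elements -/

/-- An element is `c`-axial if its powers stay `c`-close to straight: `1` is nearly on a geodesic
between any negative and any positive power. In a hyperbolic group the axial elements of infinite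
order are the loxodromic ones. -/
def IsAxial (d : G → G → ℝ) (c : ℝ) (g : G) : Prop :=
  ∀ p q : ℕ, gromovProduct d 1 (g ^ p)⁻¹ (g ^ q) ≤ c

theorem IsAxial.inv (hd : IsWordMetric d) {c : ℝ} {g : G} (hg : IsAxial d c g) :
    IsAxial d c g⁻¹ := by
  intro p q
  rw [inv_pow, inv_pow, inv_inv, gromovProduct_comm hd]
  exact hg q p

theorem IsAxial.gromovProduct_pow_le (hd : IsWordMetric d) {c : ℝ} {g : G} (hg : IsAxial d c g)
    {i n : ℕ} (hin : i ≤ n) : gromovProduct d (g ^ i) 1 (g ^ n) ≤ c := by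
  have := hg i (n - i)
  rw [← gromovProduct_mul_left hd (g ^ i)] at this
  rwa [mul_one, mul_inv_cancel, ← pow_add, Nat.add_sub_cancel' hin] at this

/-- The case `q = 1` of `IsAxial`, by the local-to-global principle for the path of the powers of
`h` started at `h⁻¹`; the hypothesis says that its corners have small Gromov products. -/
theorem gromovProduct_inv_pow_le (hd : IsWordMetric d) (hδ : FourPoint d δ) {h : G}
    (hh : d 1 h + 3 * δ < d 1 (h * h)) (p : ℕ) :
    gromovProduct d 1 (h ^ p)⁻¹ h ≤ gromovProduct d 1 h⁻¹ h + δ := by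
  have hδ0 := hδ.nonneg hd
  have hnn := gromovProduct_nonneg hd 1 h⁻¹ h
  cases p with
  | zero =>
    have := gromovProduct_le_left hd 1 1 h
    rw [hd.self] at this
    simp only [pow_zero, inv_one]
    linarith
  | succ k =>
    have ha : gromovProduct d 1 h⁻¹ h = d 1 h - d 1 (h * h) / 2 := by
      rw [gromovProduct_one hd, hd.norm_inv, inv_inv]
      ring
    have := hδ.chain hd (x := fun i => h ^ i) (o := h⁻¹) (a := gromovProduct d 1 h⁻¹ h)
      (L := d 1 h) (by simp; linarith)
      (fun i => by simp only [pow_succ, hd.dist_mul_right, le_refl])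
      (fun i => by
        refine le_of_eq ?_
        rw [← gromovProduct_mul_left hd (h ^ (i + 1)) 1]
        congr 1 <;> simp [pow_succ]) (by linarith) k
    rw [← gromovProduct_mul_left hd (h ^ k)⁻¹] at this
    rwa [inv_mul_cancel, pow_succ, inv_mul_cancel_left, ← mul_inv_rev, ← pow_succ'] at this

theorem isAxial_of_lt_norm_sq (hd : IsWordMetric d) (hδ : FourPoint d δ) {h : G}
    (hh : d 1 h + 3 * δ < d 1 (h * h)) : ∃ c, IsAxial d c h := by
  have hδ0 := hδ.nonneg hd
  have hnn := gromovProduct_nonneg hd 1 h⁻¹ h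
  have ha : gromovProduct d 1 h⁻¹ h = d 1 h - d 1 (h * h) / 2 := by
    rw [gromovProduct_one hd, hd.norm_inv, inv_inv]
    ring
  have hh' : d 1 h⁻¹ + 3 * δ < d 1 (h⁻¹ * h⁻¹) := by
    rwa [← mul_inv_rev, hd.norm_inv, hd.norm_inv]
  refine ⟨gromovProduct d 1 h⁻¹ h + 2 * δ, fun p q => ?_⟩
  have h1 := gromovProduct_inv_pow_le hd hδ hh p
  cases q with
  | zero =>
    have := gromovProduct_le_right hd 1 (h ^ p)⁻¹ 1
    rw [hd.self] at this
    simp only [pow_zero]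
    linarith
  | succ k =>
    have h2 := gromovProduct_inv_pow_le hd hδ hh' k
    rw [inv_pow, inv_inv, inv_inv, gromovProduct_comm hd 1 h h⁻¹,
      ← gromovProduct_mul_left hd h] at h2
    rw [mul_one, mul_inv_cancel, ← pow_succ', gromovProduct_comm hd] at h2
    have h3 := gromovProduct_add_swap hd 1 (h ^ (k + 1)) h
    rw [gromovProduct_comm hd h _ 1] at h3
    have h4 := hδ 1 (h ^ p)⁻¹ (h ^ (k + 1)) h
    by_contra! hlt
    have h5 : gromovProduct d 1 h⁻¹ h + 2 * δ < min (gromovProduct d 1 (h ^ p)⁻¹ (h ^ (k + 1)))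
        (gromovProduct d 1 (h ^ (k + 1)) h) := lt_min hlt (by linarith)
    linarith

/-- If the square of the geodesic word `x * y` is short, then `x * y` and its inverse have the same
first half up to a bounded error, that is, `x` is close to `y⁻¹`. -/
theorem norm_swap_le (hd : IsWordMetric d) (hδ : FourPoint d δ) {x y : G} {D C : ℝ} (hC : 0 ≤ C)
    (hx : d 1 x = D) (hy : d 1 y = D) (hxy : d 1 (x * y) = 2 * D)
    (hsq : d 1 ((x * y) * (x * y)) ≤ d 1 (x * y) + C) : d 1 (y * x) ≤ C + 4 * δ := by
  have h := hδ.dist_le_of_fellow hd (o := 1) (x := x) (y := y⁻¹) (z := x * y)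
    (z' := (x * y)⁻¹) (a := C / 2) (b := 0)
    (by
      rw [gromovProduct, hd.dist_mul_left_self]
      linarith)
    (by
      rw [gromovProduct, mul_inv_rev, hd.dist_mul_left_self, ← mul_inv_rev]
      simp only [hd.norm_inv]
      linarith)
    (by
      rw [gromovProduct_one hd, ← mul_inv_rev]
      simp only [hd.norm_inv]
      linarith)
    (by rw [hd.norm_inv]; linarith) (by rw [hd.norm_inv]; linarith)
  rw [hd.eq_norm, ← mul_inv_rev, hd.norm_inv] at h
  linarith

/-- An infinite hyperbolic group contains an element whose square is much longer than the element
itself. Otherwise, `|y x|` is bounded for every long geodesic word `x y` with `|x| = |y|`; for a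
geodesic word `x y z` with three equal parts, `x y z y` then cannot satisfy the assumption, because
the word `x y z y x y z y` is nearly geodesic up to a bounded change. -/
theorem exists_norm_add_lt_norm_sq [Infinite G] (hd : IsWordMetric d) (hδ : FourPoint d δ)
    {C : ℝ} (hC : 0 ≤ C) : ∃ h : G, d 1 h + C < d 1 (h * h) := by
  by_contra! hsq
  have hδ0 := hδ.nonneg hd
  obtain ⟨D, hD⟩ := exists_nat_gt (5 * (C + 4 * δ) + 6 * δ + C)
  obtain ⟨g, hg⟩ := hd.exists_lt_norm (((3 * D : ℕ) : ℝ))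
  obtain ⟨w, hw, -⟩ := hd.exists_between g (3 * D) hg.le
  obtain ⟨p, hp, hpw⟩ := hd.exists_between w (2 * D) (by rw [hw]; push_cast; linarith)
  obtain ⟨x, hx, hxp⟩ := hd.exists_between p D (by rw [hp]; push_cast; linarith)
  obtain ⟨y, rfl⟩ : ∃ y, p = x * y := ⟨x⁻¹ * p, by simp⟩
  obtain ⟨z, rfl⟩ : ∃ z, w = x * y * z := ⟨(x * y)⁻¹ * w, by rw [mul_inv_cancel_left]⟩
  push_cast at hw hp
  rw [hd.dist_mul_right, hw, Nat.cast_mul, Nat.cast_ofNat] at hpw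
  rw [hd.dist_mul_right, hp] at hxp
  have hy : d 1 y = D := by linarith
  have hz : d 1 z = D := by linarith
  have hyz : d 1 (y * z) = 2 * D := by
    have h1 := hd.norm_mul_le y z
    have h2 := hd.norm_mul_le x (y * z)
    rw [← mul_assoc] at h2
    linarith
  have hs := norm_swap_le hd hδ hC hx hy hp (hsq _)
  have ht := norm_swap_le hd hδ hC hy hz hyz (hsq _)
  -- The Gromov product of the two halves of the square is bounded by means of the corner at `1`
  -- between `y⁻¹` and `z * y * x`.
  have h1 : gromovProduct d 1 y⁻¹ (z * y * x) ≤ C + 4 * δ := by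
    have h := gromovProduct_le_add hd 1 y⁻¹ (z * y * x) 1 y⁻¹ z
    have h0 : gromovProduct d 1 y⁻¹ z = 0 := by
      rw [gromovProduct_one hd, hd.norm_inv, inv_inv, hyz]
      linarith
    rw [hd.self, hd.self, hd.symm (z * y * x), mul_assoc, hd.dist_mul_right, ← mul_assoc] at h
    linarith
  have h2 : gromovProduct d 1 y⁻¹ (x * y)⁻¹ = D := by
    rw [gromovProduct_one hd, mul_inv_rev, inv_inv, mul_inv_cancel_left, ← mul_inv_rev]
    simp only [hd.norm_inv]
    linarith
  have h3 : D - (C + 4 * δ) ≤ gromovProduct d 1 (z * y * (x * y)) (z * y * x) := by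
    have h := gromovProduct_le_add hd (z * y) (z * y * (x * y)) (z * y * x) 1
      (z * y * (x * y)) (z * y * x)
    have h0 : gromovProduct d (z * y) (z * y * (x * y)) (z * y * x) = D := by
      rw [← gromovProduct_mul_left hd (z * y)⁻¹]
      rw [inv_mul_cancel, inv_mul_cancel_left, inv_mul_cancel_left, gromovProduct,
        hd.dist_mul_left_self, hd.symm _ 1, hd.symm _ 1]
      linarith
    rw [hd.self, hd.self, hd.symm (z * y) 1] at h
    linarith
  have h4 : gromovProduct d 1 (x * y)⁻¹ (z * y * (x * y)) ≤ C + 4 * δ + 2 * δ := by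
    by_contra! hlt
    have h := hδ.min_three hd 1 y⁻¹ (x * y)⁻¹ (z * y * (x * y)) (z * y * x)
      (t := min (gromovProduct d 1 (x * y)⁻¹ (z * y * (x * y))) (D - (C + 4 * δ)))
      ((min_le_right _ _).trans (by linarith)) (min_le_left _ _) ((min_le_right _ _).trans h3)
    have h' := lt_min hlt (show C + 4 * δ + 2 * δ < D - (C + 4 * δ) by linarith)
    linarith
  set f := x * y * (z * y) with hf
  have h5 : d 1 (x * y) ≤ d 1 f + d 1 (z * y) := by
    have := hd.tri 1 f (x * y)
    rwa [hd.symm f, hd.dist_mul_right] at this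
  have h6 : d 1 f - d 1 (f * f) / 2 = gromovProduct d f 1 (f * f) := by
    rw [gromovProduct, hd.dist_mul_left_self]
    ring
  have h7 := gromovProduct_le_add hd f 1 (f * f) (x * y) 1 (x * y * (z * y * (x * y)))
  have h8 : f * f = x * y * (z * y * (x * y)) * (z * y) := by simp only [hf, mul_assoc]
  rw [← gromovProduct_mul_left hd (x * y)⁻¹ (x * y), inv_mul_cancel, mul_one,
    inv_mul_cancel_left, hd.self, hd.dist_mul_left_self, h8,
    hd.dist_mul_left_self, ← h8] at h7
  linarith [hsq f]

theorem exists_isAxial [Infinite G] (hd : IsWordMetric d) (hδ : FourPoint d δ) :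
    ∃ g : G, g ≠ 1 ∧ ∃ c, IsAxial d c g := by
  have hδ0 := hδ.nonneg hd
  obtain ⟨g, hg⟩ := exists_norm_add_lt_norm_sq hd hδ (C := 3 * δ) (by linarith)
  refine ⟨g, ?_, isAxial_of_lt_norm_sq hd hδ hg⟩
  rintro rfl
  rw [mul_one, hd.self] at hg
  linarith

end Hyperbolic

/-! ### The commensurator of an infinite cyclic group -/

section Commensurator

variable {G : Type*} [Group G] {d : G → G → ℝ} {δ : ℝ}

/-- The commensurator of the cyclic group generated by `g`: the elements `t` with
`t * g ^ m = g ^ n * t` for some non-zero `m`, `n`. -/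
def cyclicCommensurator (g : G) : Subgroup G where
  carrier := {t | ∃ m n : ℤ, m ≠ 0 ∧ n ≠ 0 ∧ t * g ^ m = g ^ n * t}
  one_mem' := ⟨1, 1, one_ne_zero, one_ne_zero, by simp⟩
  mul_mem' := by
    rintro s t ⟨m, n, hm, hn, h⟩ ⟨m', n', hm', hn', h'⟩
    refine ⟨m' * m, n * n', mul_ne_zero hm' hm, mul_ne_zero hn hn', ?_⟩
    have h1 : SemiconjBy s (g ^ m) (g ^ n) := h
    have h2 : SemiconjBy t (g ^ m') (g ^ n') := h'
    have h3 := h1.zpow_right n'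
    have h4 := h2.zpow_right m
    simp only [← zpow_mul] at h3 h4
    rw [mul_comm m n'] at h3
    exact h3.mul_left h4
  inv_mem' := by
    rintro t ⟨m, n, hm, hn, h⟩
    exact ⟨n, m, hn, hm, (SemiconjBy.inv_symm_left (show SemiconjBy t (g ^ m) (g ^ n) from h))⟩

theorem mem_cyclicCommensurator {g t : G} :
    t ∈ cyclicCommensurator g ↔ ∃ m n : ℤ, m ≠ 0 ∧ n ≠ 0 ∧ t * g ^ m = g ^ n * t :=
  Iff.rfl

/-- A discrete intermediate value theorem. -/
theorem exists_mem_Icc_of_step_le {f : ℕ → ℝ} {r s : ℝ} (hf : ∀ j, f (j + 1) ≤ f j + s)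
    (h0 : f 0 ≤ r + s) {m : ℕ} (hm : r ≤ f m) : ∃ j ≤ m, r ≤ f j ∧ f j ≤ r + s := by
  classical
  have hex : ∃ j, r ≤ f j := ⟨m, hm⟩
  refine ⟨Nat.find hex, Nat.find_min' hex hm, Nat.find_spec hex, ?_⟩
  rcases hj : Nat.find hex with _ | j
  · exact h0
  · have := Nat.find_min hex (m := j) (by omega)
    linarith [hf j]

/-- If two quasi-axes `⟨a⟩` and `h⟨b⟩` run parallel for a long time, then `h` conjugates a power of
`b` to a power of `a`: along the way only finitely many differences `a⁻ⁱ h bʲ` are possible. -/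
theorem exists_pow_mul_eq_of_unbounded (hd : IsWordMetric d) (hδ : FourPoint d δ) {c : ℝ}
    {a b h : G} (ha : IsAxial d c a) (hb : IsAxial d c b)
    (hub : ∀ T : ℝ, ∃ n m : ℕ, T < gromovProduct d 1 (a ^ n) (h * b ^ m)) :
    ∃ i i' j j' : ℕ, i ≠ i' ∧ (a ^ i)⁻¹ * (h * b ^ j) = (a ^ i')⁻¹ * (h * b ^ j') := by
  classical
  have hfin := hd.finite_ball (d 1 h + d 1 b + 2 * (c + d 1 h) + 4 * δ)
  set B := hfin.toFinset with hB
  obtain ⟨n, m, hnm⟩ := hub ((B.card : ℝ) * d 1 a)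
  have hna := hd.nonneg 1 a
  have key : ∀ i ∈ Finset.range (B.card + 1), ∃ j : ℕ, (a ^ i)⁻¹ * (h * b ^ j) ∈ B := by
    intro i hi
    have hi' : i ≤ B.card := Nat.lt_succ_iff.1 (Finset.mem_range.1 hi)
    have h1 : d 1 (a ^ i) ≤ B.card * d 1 a := (hd.norm_pow_le a i).trans
      (mul_le_mul_of_nonneg_right (by exact_mod_cast hi') hna)
    have hin : i ≤ n := by
      by_contra! hlt
      have h2 : (n : ℝ) ≤ B.card := by exact_mod_cast hlt.le.trans hi'
      have h3 := (gromovProduct_le_left hd 1 (a ^ n) (h * b ^ m)).trans (hd.norm_pow_le a n)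
      linarith [mul_le_mul_of_nonneg_right h2 hna]
    obtain ⟨j, hjm, hj1, hj2⟩ := exists_mem_Icc_of_step_le (f := fun j => d 1 (h * b ^ j))
      (r := d 1 (a ^ i)) (s := d 1 h + d 1 b) (m := m)
      (fun j => by
        have := hd.norm_mul_le (h * b ^ j) b
        rw [mul_assoc, ← pow_succ] at this
        linarith [hd.nonneg 1 h])
      (by simp; linarith [hd.nonneg 1 b, hd.nonneg 1 (a ^ i)])
      (by linarith [gromovProduct_le_right hd 1 (a ^ n) (h * b ^ m)])
    have hx : gromovProduct d (a ^ i) 1 (a ^ n) ≤ c + d 1 h := by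
      linarith [ha.gromovProduct_pow_le hd hin, hd.nonneg 1 h]
    have hy : gromovProduct d (h * b ^ j) 1 (h * b ^ m) ≤ c + d 1 h := by
      have h2 := gromovProduct_le_add hd (h * b ^ j) 1 (h * b ^ m) (h * b ^ j) (h * 1) (h * b ^ m)
      rw [gromovProduct_mul_left hd, hd.self, hd.self, mul_one] at h2
      linarith [hb.gromovProduct_pow_le hd hjm]
    have h2 := hδ.dist_le_of_fellow hd hx hy
      (by linarith [(gromovProduct_nonneg hd _ _ _).trans hx]) hj1 hj2
    refine ⟨j, ?_⟩
    rw [hB, Set.Finite.mem_toFinset, Set.mem_ofPred_eq, ← hd.eq_norm]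
    linarith
  choose! j hj using key
  obtain ⟨i, -, i', -, hne, heq⟩ := Finset.exists_ne_map_eq_of_card_lt_of_maps_to
    (by simp) hj
  exact ⟨i, i', j i, j i', hne, heq⟩

theorem exists_gromovProduct_pow_le (hd : IsWordMetric d) (hδ : FourPoint d δ) {c : ℝ}
    {g h : G} (hg : IsAxial d c g) (hinf : ¬ IsOfFinOrder g) (hh : h ∉ cyclicCommensurator g)
    {a b : G} (ha : a = g ∨ a = g⁻¹) (hb : b = g ∨ b = g⁻¹) :
    ∃ C : ℝ, ∀ n m : ℕ, gromovProduct d 1 (a ^ n) (h * b ^ m) ≤ C := by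
  by_contra! hub
  have ha' : IsAxial d c a := by rcases ha with rfl | rfl; exacts [hg, hg.inv hd]
  have hb' : IsAxial d c b := by rcases hb with rfl | rfl; exacts [hg, hg.inv hd]
  obtain ⟨i, i', j, j', hne, heq⟩ := exists_pow_mul_eq_of_unbounded hd hδ ha' hb' hub
  obtain ⟨ε, hε, rfl⟩ : ∃ ε : ℤ, ε ≠ 0 ∧ a = g ^ ε := by
    rcases ha with rfl | rfl
    exacts [⟨1, by simp, by simp⟩, ⟨-1, by simp, by simp⟩]
  obtain ⟨ε', hε', rfl⟩ : ∃ ε : ℤ, ε ≠ 0 ∧ b = g ^ ε := by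
    rcases hb with rfl | rfl
    exacts [⟨1, by simp, by simp⟩, ⟨-1, by simp, by simp⟩]
  have hconj : h * g ^ (ε' * (j - j')) = g ^ (ε * (i - i')) * h := by
    simp only [mul_sub, zpow_sub, zpow_mul, zpow_natCast]
    rw [inv_mul_eq_iff_eq_mul] at heq
    rw [← mul_assoc, mul_inv_eq_iff_eq_mul, heq]
    simp only [mul_assoc]
  have hi0 : ε * ((i : ℤ) - i') ≠ 0 := mul_ne_zero hε (sub_ne_zero.2 (by exact_mod_cast hne))
  refine hh (mem_cyclicCommensurator.2 ⟨_, _, ?_, hi0, hconj⟩)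
  intro h0
  rw [h0, zpow_zero, mul_one, right_eq_mul] at hconj
  exact hinf (isOfFinOrder_iff_zpow_eq_one.2 ⟨_, hi0, hconj⟩)

/-- If `h` does not lie in the commensurator of `⟨g⟩`, the quasi-axes `⟨g⟩` and `h⟨g⟩` diverge in
all directions. -/
theorem exists_gromovProduct_zpow_le (hd : IsWordMetric d) (hδ : FourPoint d δ) {c : ℝ}
    {g h : G} (hg : IsAxial d c g) (hinf : ¬ IsOfFinOrder g) (hh : h ∉ cyclicCommensurator g) :
    ∃ C : ℝ, ∀ n m : ℤ, gromovProduct d 1 (g ^ n) (h * g ^ m) ≤ C := by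
  obtain ⟨C₁, h₁⟩ := exists_gromovProduct_pow_le hd hδ hg hinf hh (.inl rfl) (.inl rfl)
  obtain ⟨C₂, h₂⟩ := exists_gromovProduct_pow_le hd hδ hg hinf hh (.inl rfl) (.inr rfl)
  obtain ⟨C₃, h₃⟩ := exists_gromovProduct_pow_le hd hδ hg hinf hh (.inr rfl) (.inl rfl)
  obtain ⟨C₄, h₄⟩ := exists_gromovProduct_pow_le hd hδ hg hinf hh (.inr rfl) (.inr rfl)
  refine ⟨max (max C₁ C₂) (max C₃ C₄), fun n m => ?_⟩
  obtain ⟨n, rfl | rfl⟩ := n.eq_nat_or_neg <;> obtain ⟨m, rfl | rfl⟩ := m.eq_nat_or_neg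
  all_goals simp only [zpow_neg, zpow_natCast, ← inv_pow, le_max_iff]
  exacts [.inl (.inl (h₁ n m)), .inl (.inr (h₂ n m)), .inr (.inl (h₃ n m)), .inr (.inr (h₄ n m))]

/-- An element carrying a quasi-axis `⟨g⟩` to within finite distance of the quasi-axis `⟨a⟩` lies
uniformly close to `⟨a⟩`. -/
theorem exists_dist_zpow_le (hd : IsWordMetric d) (hδ : FourPoint d δ) {c : ℝ}
    {g a t : G} (hg : IsAxial d c g) (ha : IsAxial d c a) (hinf : ¬ IsOfFinOrder a)
    {m N : ℕ} (hN : N ≠ 0) (ht : t * g ^ m = a ^ N * t) :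
    ∃ j : ℤ, d t (a ^ j) ≤ d 1 a + 2 * (c + 2 * δ) + 4 * δ := by
  have hδ0 := hδ.nonneg hd
  obtain ⟨k, hk⟩ := hd.exists_lt_norm_pow (g := a ^ N) (by simpa [isOfFinOrder_pow, hN] using hinf)
    (2 * d 1 t + 2 * c + 4 * δ)
  have hsc : SemiconjBy t ((g ^ m) ^ k) ((a ^ N) ^ k) :=
    SemiconjBy.pow_right (show SemiconjBy t _ _ from ht) k
  rw [← pow_mul, ← pow_mul] at hsc
  rw [← pow_mul] at hk
  have hsc' : t * (g ^ (m * k))⁻¹ = (a ^ (N * k))⁻¹ * t := hsc.inv_right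
  have hc : 0 ≤ c := (gromovProduct_nonneg hd _ _ _).trans (hg 0 0)
  have hnt := hd.nonneg 1 t
  set A := a ^ (N * k) with hA
  have h1 : gromovProduct d t (A⁻¹ * t) (A * t) ≤ c := by
    have := hg (m * k) (m * k)
    rwa [← gromovProduct_mul_left hd t, mul_one, hsc', hsc.eq] at this
  have hP : ∀ B : G, d 1 B = d 1 A → d 1 A - 2 * d 1 t ≤ gromovProduct d t (B * t) B := by
    intro B hB
    rw [gromovProduct, hd.dist_mul_left_self]
    linarith [hd.tri 1 t B, hd.symm B t, hd.tri B (B * t) t, hd.dist_mul_right B t]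
  have h2 : gromovProduct d t A⁻¹ A ≤ c + 2 * δ := by
    by_contra! hlt
    have h3 := hδ.min_three hd t (A⁻¹ * t) A⁻¹ A (A * t)
      (t := min (gromovProduct d t A⁻¹ A) (d 1 A - 2 * d 1 t))
      ((min_le_right _ _).trans (hP A⁻¹ (hd.norm_inv A))) (min_le_left _ _)
      ((min_le_right _ _).trans (by rw [gromovProduct_comm hd]; exact hP A rfl))
    have h4 := lt_min hlt (show c + 2 * δ < d 1 A - 2 * d 1 t by linarith)
    linarith
  have hle : d A⁻¹ t ≤ d A⁻¹ A := by
    have h3 := hd.tri 1 t A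
    simp only [gromovProduct] at h2
    linarith [hd.symm A t]
  have hpow : a ^ (2 * (N * k)) = A * A := by rw [two_mul, pow_add]
  obtain ⟨j, hj, hj1, hj2⟩ := exists_mem_Icc_of_step_le (f := fun j => d 1 (a ^ j))
    (r := d A⁻¹ t) (s := d 1 a) (m := 2 * (N * k))
    (fun j => by rw [pow_succ]; exact hd.norm_mul_le _ _)
    (by simp only [pow_zero, hd.self]; linarith [hd.nonneg A⁻¹ t, hd.nonneg 1 a])
    (by rw [hpow]; rwa [hd.eq_norm A⁻¹ A, inv_inv] at hle)
  have hy : gromovProduct d (A⁻¹ * a ^ j) A⁻¹ A ≤ c + 2 * δ := by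
    have h3 := ha.gromovProduct_pow_le hd hj
    rw [← gromovProduct_mul_left hd A⁻¹, mul_one, hpow, inv_mul_cancel_left] at h3
    linarith
  have h3 := hδ.dist_le_of_fellow hd (o := A⁻¹) (b := d 1 a) h2 hy
    (by
      simp only [gromovProduct, hd.self, hd.symm A A⁻¹]
      linarith)
    (by rwa [hd.dist_mul_right]) (by rwa [hd.dist_mul_right])
  refine ⟨j - (N * k : ℕ), ?_⟩
  rwa [zpow_sub, zpow_natCast, zpow_natCast, ← hA, ← ((Commute.refl a).pow_pow _ _).inv_left.eq]

theorem exists_dist_zpow_le_of_mem (hd : IsWordMetric d) (hδ : FourPoint d δ) {c : ℝ} {g t : G}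
    (hg : IsAxial d c g) (hinf : ¬ IsOfFinOrder g) (ht : t ∈ cyclicCommensurator g) :
    ∃ j : ℤ, d t (g ^ j) ≤ d 1 g + 2 * (c + 2 * δ) + 4 * δ := by
  obtain ⟨m, n, hm, hn, h⟩ := mem_cyclicCommensurator.1 ht
  obtain ⟨M, n, hn, h⟩ : ∃ (M : ℕ) (n : ℤ), n ≠ 0 ∧ t * g ^ M = g ^ n * t := by
    obtain ⟨M, rfl | rfl⟩ := m.eq_nat_or_neg
    · exact ⟨M, n, hn, by simpa using h⟩
    · refine ⟨M, -n, neg_ne_zero.2 hn, ?_⟩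
      have := (show SemiconjBy t (g ^ (-(M : ℤ))) (g ^ n) from h).inv_right.eq
      simpa using this
  obtain ⟨N, rfl | rfl⟩ := n.eq_nat_or_neg
  · exact exists_dist_zpow_le hd hδ hg hg hinf (by simpa using hn) (by simpa using h)
  · obtain ⟨j, hj⟩ := exists_dist_zpow_le hd hδ hg (hg.inv hd) (by simpa using hinf) (N := N)
      (by simpa using hn) (by simpa using h)
    rw [hd.norm_inv] at hj
    exact ⟨-j, by simpa using hj⟩

/-- The infinite cyclic group generated by an axial element has finite index in its
commensurator: every element of the commensurator is a power times an element of a finite set. -/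
theorem exists_finite_zpow_mul (hd : IsWordMetric d) (hδ : FourPoint d δ) {c : ℝ} {g : G}
    (hg : IsAxial d c g) (hinf : ¬ IsOfFinOrder g) :
    ∃ B : Set G, B.Finite ∧ ∀ t ∈ cyclicCommensurator g, ∃ j : ℤ, ∃ b ∈ B, t = g ^ j * b := by
  refine ⟨_, hd.finite_ball (d 1 g + 2 * (c + 2 * δ) + 4 * δ), fun t ht => ?_⟩
  obtain ⟨j, hj⟩ := exists_dist_zpow_le_of_mem hd hδ hg hinf ht
  refine ⟨j, (g ^ j)⁻¹ * t, ?_, by simp⟩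
  rwa [Set.mem_ofPred_eq, ← hd.eq_norm, hd.symm]

/-- A group that is not virtually cyclic is not covered by finitely many cosets of the
commensurator of an axial element. -/
theorem exists_forall_inv_mul_notMem (hd : IsWordMetric d) (hδ : FourPoint d δ) {c : ℝ} {g : G}
    (hg : IsAxial d c g) (hinf : ¬ IsOfFinOrder g) (hcyc : ¬ IsVirtuallyCyclic G) {T : Set G}
    (hT : T.Finite) : ∃ u, ∀ r ∈ T, r⁻¹ * u ∉ cyclicCommensurator g := by
  by_contra! hcov
  obtain ⟨B, hB, hdec⟩ := exists_finite_zpow_mul hd hδ hg hinf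
  refine hcyc ⟨Subgroup.zpowers g, Subgroup.finiteIndex_iff_finite_quotient.2 ?_, inferInstance⟩
  refine Set.finite_univ_iff.1 (((Set.Finite.image2 (fun r b : G => r * b⁻¹) hT hB).image
    (QuotientGroup.mk (s := Subgroup.zpowers g))).subset fun x _ => ?_)
  induction x using QuotientGroup.induction_on with
  | H u =>
    obtain ⟨r, hr, hru⟩ := hcov u
    obtain ⟨j, b, hb, hj⟩ := hdec _ (inv_mem hru)
    refine ⟨r * b⁻¹, ⟨r, hr, b, hb, rfl⟩, QuotientGroup.eq.2 ⟨-j, ?_⟩⟩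
    have hu : u = r * (b⁻¹ * g ^ (-j)) := by
      rw [zpow_neg, ← mul_inv_rev, ← hj]
      simp
    simp only [hu]
    group

/-- Two powers of `e` lie in the same coset of `⟨g⟩`, of which there are only finitely many in the
commensurator. -/
theorem exists_zpow_eq_zpow_of_mem (hd : IsWordMetric d) (hδ : FourPoint d δ) {c : ℝ} {g e : G}
    (hg : IsAxial d c g) (hinf : ¬ IsOfFinOrder g) (he : e ∈ cyclicCommensurator g) :
    ∃ p q : ℤ, p ≠ 0 ∧ e ^ p = g ^ q := by
  obtain ⟨B, hB, hdec⟩ := exists_finite_zpow_mul hd hδ hg hinf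
  choose! j b hb hj using hdec
  obtain ⟨k, -, k', -, hne, heq⟩ := Set.infinite_univ.exists_ne_map_eq_of_mapsTo
    (f := fun k : ℕ => b (e ^ k)) (t := B) (fun k _ => hb _ (pow_mem he k)) hB
  refine ⟨k - k', j (e ^ k) - j (e ^ k'), sub_ne_zero.2 (by exact_mod_cast hne), ?_⟩
  have h1 := hj _ (pow_mem he k)
  have h2 := hj _ (pow_mem he k')
  rw [show b (e ^ k) = b (e ^ k') from heq] at h1
  rw [zpow_sub, zpow_sub, zpow_natCast, zpow_natCast, eq_mul_inv_of_mul_eq h1.symm,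
    eq_mul_inv_of_mul_eq h2.symm]
  group

/-- In a torsion-free hyperbolic group, distinct conjugates of the commensurator of an axial element
intersect trivially. -/
theorem inv_mul_mem_of_conj_mem (hd : IsWordMetric d) (hδ : FourPoint d δ)
    (hfree : IsTorsionFreeGroup G) {c : ℝ} {g u v w : G} (hg : IsAxial d c g)
    (hinf : ¬ IsOfFinOrder g) (hw : w ≠ 1) (hu : u⁻¹ * w * u ∈ cyclicCommensurator g)
    (hv : v⁻¹ * w * v ∈ cyclicCommensurator g) : u⁻¹ * v ∈ cyclicCommensurator g := by
  obtain ⟨p, q, hp, hpq⟩ := exists_zpow_eq_zpow_of_mem hd hδ hg hinf hu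
  obtain ⟨p', q', hp', hpq'⟩ := exists_zpow_eq_zpow_of_mem hd hδ hg hinf hv
  have hconj : ∀ (x : G) (n : ℤ), (x⁻¹ * w * x) ^ n = x⁻¹ * w ^ n * x := by
    intro x n
    simpa using conj_zpow (i := n) (a := x⁻¹) (b := w)
  have hne : ∀ (x : G) (n q : ℤ), n ≠ 0 → (x⁻¹ * w * x) ^ n = g ^ q → q ≠ 0 := by
    rintro x n q hn hq rfl
    rw [hconj, zpow_zero, mul_eq_one_iff_eq_inv, inv_mul_eq_iff_eq_mul, mul_inv_cancel] at hq
    exact hfree w hw (isOfFinOrder_iff_zpow_eq_one.2 ⟨n, hn, hq⟩)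
  refine mem_cyclicCommensurator.2 ⟨q' * p, q * p', mul_ne_zero (hne v p' q' hp' hpq') hp,
    mul_ne_zero (hne u p q hp hpq) hp', ?_⟩
  rw [zpow_mul, ← hpq', zpow_mul, ← hpq, ← zpow_mul, ← zpow_mul, hconj, hconj, mul_comm p' p]
  group

/-! ### Elements in general position -/

/-- `ξ⁻¹` if `b` is `true` and `ξ` otherwise, matching the orientation of the darts of the graph
with edges `{x, x * ξ}`. -/
def signedPow (ξ : G) (b : Bool) : G := if b then ξ⁻¹ else ξ

/-- For every finite set `F` there is an element `ξ` that is long compared with the Gromov products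
of `ξ ^ (-ε)` and `w * ξ ^ ε'` for `w ∈ F`, except for the products with `w = 1` and `ε' = -ε`,
where the two points agree. -/
theorem exists_general_position (hd : IsWordMetric d) (hδ : FourPoint d δ)
    (hfree : IsTorsionFreeGroup G) (hcyc : ¬ IsVirtuallyCyclic G) {F : Set G} (hF : F.Finite)
    (R : ℝ) : ∃ (ξ : G) (A : ℝ), 2 * A + R < d 1 ξ ∧ ∀ b b' : Bool, ∀ w ∈ F,
      (w = 1 → b' = b) → gromovProduct d 1 (signedPow ξ b)⁻¹ (w * signedPow ξ b') ≤ A := by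
  classical
  have : Infinite G := by
    by_contra hfin
    have := not_infinite_iff_finite.1 hfin
    exact hcyc ⟨⊥, inferInstance, inferInstance⟩
  obtain ⟨g, hg1, c, hg⟩ := exists_isAxial hd hδ
  have hinf := hfree g hg1
  set E := cyclicCommensurator g with hE
  -- For every `w ≠ 1`, the elements `u` with `u⁻¹ * w * u ∈ E` form at most one coset of `E`.
  have hcoset : ∀ w : G, ∃ r : G, w ≠ 1 → ∀ u, u⁻¹ * w * u ∈ E → r⁻¹ * u ∈ E := by
    intro w
    by_cases h : ∃ r, r⁻¹ * w * r ∈ E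
    · obtain ⟨r, hr⟩ := h
      exact ⟨r, fun hw u hu => inv_mul_mem_of_conj_mem hd hδ hfree hg hinf hw hr hu⟩
    · push Not at h
      exact ⟨1, fun _ u hu => absurd hu (h u)⟩
  choose r hr using hcoset
  obtain ⟨u, hu⟩ := exists_forall_inv_mul_notMem hd hδ hg hinf hcyc (hF.image r)
  obtain ⟨v, hv⟩ := exists_forall_inv_mul_notMem hd hδ hg hinf hcyc
    ((hF.image r).union ((hF.image (· * u)).union (hF.image (·⁻¹ * u))))
  have huu : ∀ w ∈ F, w ≠ 1 → u⁻¹ * w * u ∉ E := fun w hw h1 h =>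
    hu _ (Set.mem_image_of_mem r hw) (hr w h1 u h)
  have hvv : ∀ w ∈ F, w ≠ 1 → v⁻¹ * w * v ∉ E := fun w hw h1 h =>
    hv _ (Or.inl (Set.mem_image_of_mem r hw)) (hr w h1 v h)
  have hvu : ∀ w ∈ F, v⁻¹ * w * u ∉ E := fun w hw h =>
    hv _ (Or.inr (Or.inl (Set.mem_image_of_mem (· * u) hw)))
      (by simpa [mul_assoc] using inv_mem h)
  have huv : ∀ w ∈ F, u⁻¹ * w * v ∉ E := fun w hw h =>
    hv _ (Or.inr (Or.inr (Set.mem_image_of_mem (·⁻¹ * u) hw)))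
      (by simpa [mul_assoc] using h)
  have hbound : ∀ h : G, ∃ C : ℝ, h ∉ E → ∀ n m : ℤ, gromovProduct d 1 (g ^ n) (h * g ^ m) ≤ C := by
    intro h
    by_cases hh : h ∈ E
    · exact ⟨0, fun h' => absurd hh h'⟩
    · obtain ⟨C, hC⟩ := exists_gromovProduct_zpow_le hd hδ hg hinf hh
      exact ⟨C, fun _ => hC⟩
  choose C hC using hbound
  obtain ⟨K, hK⟩ : ∃ K, ∀ x ∈ ({u, v} : Set G), ∀ y ∈ ({u, v} : Set G), ∀ w ∈ F,
      C (x⁻¹ * w * y) ≤ K := by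
    have hfin : ({u, v} : Set G).Finite := Set.toFinite _
    obtain ⟨K, hK⟩ := ((Set.Finite.image2 (fun (x : G) (p : G × G) => C (x⁻¹ * p.2 * p.1)) hfin
      (hfin.prod hF))).bddAbove
    exact ⟨K, fun x hx y hy w hw => hK ⟨x, hx, (y, w), ⟨hy, hw⟩, rfl⟩⟩
  -- Both ends of `ξ` are translates of the quasi-axis of `g`, so that the Gromov products reduce
  -- to Gromov products of powers of `g`.
  have hgen : ∀ x ∈ ({u, v} : Set G), ∀ y ∈ ({u, v} : Set G), ∀ x' ∈ ({u, v} : Set G),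
      ∀ y' ∈ ({u, v} : Set G), ∀ w ∈ F, x⁻¹ * w * y ∉ E → ∀ n m : ℤ,
      gromovProduct d 1 (x * g ^ n * x'⁻¹) (w * (y * g ^ m * y'⁻¹)) ≤
        K + 3 * (d 1 u + d 1 v) := by
    intro x hx y hy x' hx' y' hy' w hw hE n m
    have hnorm : ∀ z ∈ ({u, v} : Set G), d 1 z ≤ d 1 u + d 1 v := by
      rintro z (rfl | rfl)
      · linarith [hd.nonneg 1 v]
      · linarith [hd.nonneg 1 u]
    have h1 := gromovProduct_le_add hd 1 (x * g ^ n * x'⁻¹) (w * (y * g ^ m) * y'⁻¹) (x * 1)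
      (x * g ^ n) (x * (x⁻¹ * w * y * g ^ m))
    have h2 : x * (x⁻¹ * w * y * g ^ m) = w * (y * g ^ m) := by group
    rw [gromovProduct_mul_left hd, h2, hd.dist_mul_left_self, hd.dist_mul_left_self, hd.norm_inv,
      hd.norm_inv, mul_one, mul_assoc w] at h1
    linarith [hC _ hE n m, hK x hx y hy w hw, hnorm x hx, hnorm x' hx', hnorm y' hy']
  have hum : u ∈ ({u, v} : Set G) := .inl rfl
  have hvm : v ∈ ({u, v} : Set G) := .inr rfl
  obtain ⟨M, hM⟩ := hd.exists_lt_norm_pow hinf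
    (2 * (K + 3 * (d 1 u + d 1 v)) + R + d 1 u + d 1 v)
  have hinv : (u * g ^ (M : ℤ) * v⁻¹)⁻¹ = v * g ^ (-(M : ℤ)) * u⁻¹ := by group
  refine ⟨u * g ^ (M : ℤ) * v⁻¹, K + 3 * (d 1 u + d 1 v), ?_, ?_⟩
  · have h1 := hd.norm_mul_le u⁻¹ (u * g ^ (M : ℤ) * v⁻¹ * v)
    have h2 := hd.norm_mul_le (u * g ^ (M : ℤ) * v⁻¹) v
    rw [inv_mul_cancel_right, inv_mul_cancel_left, hd.norm_inv, zpow_natCast] at h1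
    rw [inv_mul_cancel_right] at h2
    simp only [zpow_natCast] at h2 ⊢
    linarith
  · rintro (_ | _) (_ | _) w hw hw1
    · simp only [signedPow, Bool.false_eq_true, if_false, hinv]
      exact hgen v hvm u hum u hum v hvm w hw (hvu w hw) _ _
    · simp only [signedPow, Bool.false_eq_true, if_false, if_true, hinv]
      exact hgen v hvm v hvm u hum u hum w hw (hvv w hw fun h => by simpa using hw1 h) _ _
    · simp only [signedPow, Bool.false_eq_true, if_false, if_true, inv_inv]
      exact hgen u hum u hum v hvm v hvm w hw (huu w hw fun h => by simpa using hw1 h) _ _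
    · simp only [signedPow, if_true, inv_inv]
      rw [hinv]
      exact hgen u hum v hvm v hvm u hum w hw (huv w hw) _ _

end Commensurator

/-! ### Tours -/

section Tour

variable {G : Type*} [Group G] {d : G → G → ℝ} {δ : ℝ}

theorem dartSrc_comp {α β γ : Type*} (φ : β → γ) (s t : α → β) (a : α × Bool) :
    dartSrc (fun e => φ (s e)) (fun e => φ (t e)) a = φ (dartSrc s t a) :=
  (apply_ite φ _ _ _).symm

theorem dartSrc_dartRev_mul (ξ : G) (a : G × Bool) :
    dartSrc id (· * ξ) (dartRev a) = dartSrc id (· * ξ) a * signedPow ξ a.2 := by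
  obtain ⟨e, _ | _⟩ := a <;> simp [dartSrc, dartRev, signedPow]

theorem dart_ext_of_dartSrc_eq {ξ : G} {a b : G × Bool} (h2 : a.2 = b.2)
    (h : dartSrc id (· * ξ) a = dartSrc id (· * ξ) b) : a = b := by
  obtain ⟨e, x⟩ := a
  obtain ⟨e', y⟩ := b
  obtain rfl : x = y := h2
  cases x <;> simpa [dartSrc] using h

/-- If `ξ` is long and in general position with respect to `F`, the graph obtained from the edges
`{x, x * ξ}` in `S` by identifying points that differ by elements of `F` is a forest: a
non-backtracking walk in it lifts to a broken path in the group which escapes to infinity. -/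
theorem card_lt_card_image (hd : IsWordMetric d) (hδ : FourPoint d δ) [DecidableEq G] {F : Set G}
    {ξ : G} {A ρ : ℝ} (hρ : ∀ w ∈ F, d 1 w ≤ ρ) (hξ : 2 * A + (5 * ρ + 2 * δ + 1) < d 1 ξ)
    (hgen : ∀ b b' : Bool, ∀ w ∈ F, (w = 1 → b' = b) →
      gromovProduct d 1 (signedPow ξ b)⁻¹ (w * signedPow ξ b') ≤ A)
    {S : Finset G} {f : G → ℕ} (hf : ∀ x ∈ S, ∀ y ∈ S, f x = f y → x⁻¹ * y ∈ F)
    (hne : (S.filter (· * ξ ∈ S)).Nonempty) :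
    (S.filter (· * ξ ∈ S)).card < (S.image f).card := by
  by_contra! hle
  have hsub : (S.filter (· * ξ ∈ S)).image (fun e => f (id e)) ∪
      (S.filter (· * ξ ∈ S)).image (fun e => f (e * ξ)) ⊆ S.image f := by
    refine Finset.union_subset ?_ ?_ <;> intro x hx <;>
      obtain ⟨e, he, rfl⟩ := Finset.mem_image.1 hx
    · exact Finset.mem_image_of_mem f (Finset.mem_filter.1 he).1
    · exact Finset.mem_image_of_mem f (Finset.mem_filter.1 he).2
  obtain ⟨a, ha⟩ := exists_nonbacktracking_walk _ _ _ hne ((Finset.card_le_card hsub).trans hle)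
  simp only [dartSrc_comp, Finset.mem_filter] at ha
  set x : ℕ → G := fun i => dartSrc id (· * ξ) (a i) with hx
  set ζ : ℕ → G := fun i => signedPow ξ (a i).2 with hζ
  have hxS : ∀ i, x i ∈ S ∧ x i * ζ i ∈ S := by
    intro i
    have h := (ha i).1
    simp only [hx, hζ, ← dartSrc_dartRev_mul]
    generalize a i = ai at h ⊢
    obtain ⟨e, _ | _⟩ := ai
    · simpa [dartSrc, dartRev] using h
    · simpa [dartSrc, dartRev] using h.symm
  set w : ℕ → G := fun i => (x i * ζ i)⁻¹ * x (i + 1) with hw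
  have hwF : ∀ i, w i ∈ F := fun i => hf _ (hxS i).2 _ (hxS (i + 1)).1 (by
    have := (ha i).2.1
    rw [dartSrc_dartRev_mul] at this
    exact this.symm)
  have hxsucc : ∀ i, x (i + 1) = x i * ζ i * w i := fun i => (mul_inv_cancel_left _ _).symm
  clear_value w
  have hturn : ∀ i, w i = 1 → (a (i + 1)).2 = (a i).2 := by
    intro i hwi
    by_contra hb
    refine (ha i).2.2 (dart_ext_of_dartSrc_eq (ξ := ξ)
      (by simpa [dartRev, Bool.eq_not] using hb) ?_)
    rw [dartSrc_dartRev_mul]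
    have := hxsucc i
    rwa [hwi, mul_one] at this
  have hζnorm : ∀ i, d 1 (ζ i) = d 1 ξ := by
    intro i
    simp only [hζ, signedPow]
    split_ifs
    · exact hd.norm_inv ξ
    · rfl
  have hlong : ∀ i, d 1 ξ - ρ ≤ d (x i) (x (i + 1)) := by
    intro i
    have h1 := hd.tri (x i) (x i * ζ i * w i) (x i * ζ i)
    rw [hd.dist_mul_right, hd.dist_mul_left_self, ← hxsucc, hζnorm] at h1
    linarith [hρ _ (hwF i)]
  have hcorner : ∀ i, gromovProduct d (x (i + 1)) (x i) (x (i + 2)) ≤ A + 2 * ρ := by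
    intro i
    have h1 := gromovProduct_le_add hd (x i * ζ i * w i) (x i * ζ i * (ζ i)⁻¹)
      (x i * ζ i * (w i * ζ (i + 1)) * w (i + 1)) (x i * ζ i * 1) (x i * ζ i * (ζ i)⁻¹)
      (x i * ζ i * (w i * ζ (i + 1)))
    rw [gromovProduct_mul_left hd, mul_one, hd.dist_mul_left_self, hd.dist_mul_left_self, hd.self,
      mul_inv_cancel_right, ← mul_assoc (x i * ζ i), ← hxsucc, ← hxsucc] at h1
    linarith [hρ _ (hwF i), hρ _ (hwF (i + 1)), hgen _ _ _ (hwF i) (hturn i)]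
  obtain ⟨K, hK⟩ := (S.finite_toSet.image (d (x 0))).bddAbove
  obtain ⟨k, hk⟩ := exists_nat_gt K
  have h1 := hδ.le_dist_chain hd hlong hcorner (by linarith) k
  have h2 : d (x 0) (x k) ≤ K := hK (Set.mem_image_of_mem _ (hxS k).1)
  nlinarith [Nat.cast_nonneg (α := ℝ) k]

/-- The pieces of length less than `R` of a tour induce an index function on the points visited. -/
theorem exists_tour_index {X : Set G} (hX : Subgroup.closure X = ⊤) (S : Finset G) {R : ℕ}
    (hR : 0 < R) : ∃ f : G → ℕ, (∀ x ∈ S, f x ≤ tourLength X S / R) ∧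
      ∀ x ∈ S, ∀ y ∈ S, f x = f y → wordDist X 1 (x⁻¹ * y) ≤ R := by
  obtain ⟨g, p, hp, hlen⟩ := exists_tour_length_eq hX S
  have hidx : ∀ x ∈ S, ∃ i, p.getVert i = x ∧ i ≤ p.length := fun x hx =>
    SimpleGraph.Walk.mem_support_iff_exists_getVert.1 (hp x hx)
  choose! idx hidx hidxle using hidx
  have hlt : ∀ i j : ℕ, i / R = j / R → j - i ≤ R := by
    intro i j hij
    have h1 := Nat.div_add_mod i R
    have h2 := Nat.div_add_mod j R
    have h3 := Nat.mod_lt j hR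
    rw [hij] at h1
    omega
  have hdist : ∀ x ∈ S, ∀ y ∈ S, idx x / R = idx y / R → idx x ≤ idx y →
      wordDist X x y ≤ R := by
    intro x hx y hy hxy hle
    have := wordDist_getVert_le p hle
    rw [hidx x hx, hidx y hy] at this
    exact this.trans (hlt _ _ hxy)
  refine ⟨fun x => idx x / R, fun x hx => Nat.div_le_div_right (hlen ▸ hidxle x hx),
    fun x hx y hy hxy => ?_⟩
  rw [← wordDist_mul_left hX x, mul_one, mul_inv_cancel_left]
  rcases le_total (idx x) (idx y) with h | h
  · exact hdist x hx y hy hxy h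
  · have := hdist y hy x hx hxy.symm h
    rwa [wordDist, SimpleGraph.dist_comm] at this

theorem card_le_two_mul_card_filter [DecidableEq G] {ξ : G} {S : Finset G}
    (hS : IsRelated {ξ} (S : Set G)) : S.card ≤ 2 * (S.filter (· * ξ ∈ S)).card := by
  have hsub : S ⊆ S.filter (· * ξ ∈ S) ∪ (S.filter (· * ξ ∈ S)).image (· * ξ) := by
    intro x hx
    obtain ⟨y, hy, z, hz, hzξ⟩ := hS x hx
    rw [Finset.mem_union]
    rcases hz with rfl | rfl <;> rw [Set.mem_singleton_iff] at hzξ <;> rw [← hzξ]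
    · exact Or.inr (Finset.mem_image.2 ⟨y, Finset.mem_filter.2 ⟨hy, by simpa using hx⟩, by simp⟩)
    · exact Or.inl (Finset.mem_filter.2 ⟨hx, by simpa using hy⟩)
  refine (Finset.card_le_card hsub).trans ((Finset.card_union_le _ _).trans ?_)
  have := Finset.card_image_le (s := S.filter (· * ξ ∈ S)) (f := (· * ξ))
  omega

end Tour

end TSGroup

theorem proposition4 {G : Type*} [Group G] (hfree : TSGroup.IsTorsionFreeGroup G)
    (hhyp : TSGroup.IsWordHyperbolic G) (hcyc : ¬ TSGroup.IsVirtuallyCyclic G) :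
    TSGroup.IsTS G := by
  classical
  obtain ⟨Y, hY, δ, hδ⟩ := hhyp
  refine ⟨⟨Y, hY⟩, fun X hX l hl => ?_⟩
  have hd := TSGroup.isWordMetric_wordDist hY Y.finite_toSet
  -- There are at least `|S| / 2` edges and at most `L / R` of them for a tour of length `L`, so
  -- that pieces of length `2 * l` suffice.
  obtain ⟨R, hR⟩ := exists_nat_ge (2 * l)
  have hR0 : 0 < R := by
    have : (0 : ℝ) < R := by linarith
    exact_mod_cast this
  have hF := TSGroup.finite_wordDist_le hX X.finite_toSet R
  obtain ⟨ρ, hρ⟩ := (hF.image fun w => (TSGroup.wordDist (Y : Set G) 1 w : ℝ)).bddAbove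
  obtain ⟨ξ, A, hξ, hgen⟩ := TSGroup.exists_general_position hd hδ hfree hcyc hF
    (5 * ρ + 2 * δ + 1)
  refine ⟨ξ, fun S hS => ?_⟩
  rcases S.eq_empty_or_nonempty with rfl | hSne
  · simp
  have hS2 := TSGroup.card_le_two_mul_card_filter hS
  have hpos := hSne.card_pos
  obtain ⟨f, hfle, hf⟩ := TSGroup.exists_tour_index hX S hR0
  have hlt := TSGroup.card_lt_card_image hd hδ (fun w hw => hρ (Set.mem_image_of_mem _ hw)) hξ hgen
    hf (Finset.card_pos.1 (by omega))
  have himage : (S.image f).card ≤ TSGroup.tourLength (X : Set G) S / R + 1 := by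
    have hsub : S.image f ⊆ Finset.range (TSGroup.tourLength (X : Set G) S / R + 1) := by
      intro i hi
      obtain ⟨x, hx, rfl⟩ := Finset.mem_image.1 hi
      exact Finset.mem_range.2 (Nat.lt_succ_of_le (hfle x hx))
    simpa using Finset.card_le_card hsub
  have hcard : R * S.card ≤ 2 * TSGroup.tourLength (X : Set G) S := by
    have h1 : S.card ≤ 2 * (TSGroup.tourLength (X : Set G) S / R) := by omega
    have h2 := Nat.mul_div_le (TSGroup.tourLength (X : Set G) S) R
    have h3 := Nat.mul_le_mul_left R h1
    linarith
  have hcard' : (R : ℝ) * S.card ≤ 2 * TSGroup.tourLength (X : Set G) S := by exact_mod_cast hcard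
  linarith [mul_le_mul_of_nonneg_right hR (Nat.cast_nonneg (α := ℝ) S.card)]
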